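/- For metric spaces $X,Y$ (distances written $|\cdot\,\cdot|$) and maps $f:X\to Y$, $g:Y\to X$ put $$\operatorname{dis} f=\sup_{x,x'\in X}\bigl||f(x)f(x')|-|xx'|\bigr|,\qquad \operatorname{codis}(f,g)=\sup_{x\in X,\,y\in Y}\bigl||f(x)\,y|-|x\,g(y)|\bigr|,$$ with values in $[0,\infty]$. The Gromov–Hausdorff distance $d_{GH}(X,Y)\in[0,\infty]$ is the infimum of the Hausdorff distances $d_H(\varphi(X),\psi(Y))$ over all metric spaces $Z$ and all isometric embeddings $\varphi:X\to Z$, $\psi:Y\to Z$. The continuous Gromov–Hausdorff distance is $$d_{GH}^c(X,Y)=\tfrac12\inf_{f,g}\max\{\operatorname{dis} f,\ \operatorname{codis}(f,g),\ \operatorname{dis} g\}\in[0,\infty],$$ where the infimum is over all continuous maps $f:X\to Y$ and $g:Y\to X$. **Theorem.** Let $V$ and $W$ be real Banach spaces, with closed unit balls $B_V$ and $B_W$. The following conditions are equivalent: 1. $V$ and $W$ are linearly isometric, that is, there is a bijective linear isometry $V\to W$; 2. $V$ and $W$ are isometric as metric spaces, that is, there is a bijective isometry $V\to W$; 3. $d_{GH}^c(V,W)=0$;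 4. $d_{GH}^c(V,W)<\infty$; 5. $d_{GH}(V,W)<\infty$; 6. $B_V$ and $B_W$ are isometric as metric spaces, that is, there is a bijective isometry $B_V\to B_W$. -/

import Mathlib

universe u v

namespace MazurUlamGH

open scoped ENNReal

/-- The Gromov--Hausdorff distance between two metric spaces, as an extended nonnegative real: the
infimum of the Hausdorff distances between the images of `X` and `Y` under isometric embeddings
into a common metric space `Z`. Taking `Z` in `Type (max u v)` is no restriction, because `Z` can
always be replaced by the union of the two images. -/
noncomputable def ghEDist (X : Type u) (Y : Type v) [MetricSpace X] [MetricSpace Y] : ℝ≥0∞ :=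
  ⨅ (Z : Type (max u v)) (_ : MetricSpace Z) (f : X → Z) (g : Y → Z)
    (_ : Isometry f) (_ : Isometry g),
    Metric.hausdorffEDist (Set.range f) (Set.range g)

/-- The distortion `sup_{x, x'} | |f(x) f(x')| - |x x'| |` of a map of metric spaces. -/
noncomputable def dis {X : Type u} {Y : Type v} [MetricSpace X] [MetricSpace Y]
    (f : X → Y) : ℝ≥0∞ :=
  ⨆ (x : X) (x' : X), ENNReal.ofReal |dist (f x) (f x') - dist x x'|

/-- The codistortion `sup_{x, y} | |f(x) y| - |x g(y)| |` of a pair of maps of metric spaces. -/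
noncomputable def codis {X : Type u} {Y : Type v} [MetricSpace X] [MetricSpace Y]
    (f : X → Y) (g : Y → X) : ℝ≥0∞ :=
  ⨆ (x : X) (y : Y), ENNReal.ofReal |dist (f x) y - dist x (g y)|

/-- The continuous Gromov--Hausdorff distance: half the infimum of
`max {dis f, codis (f, g), dis g}` over all continuous `f : X → Y` and `g : Y → X`. -/
noncomputable def cghEDist (X : Type u) (Y : Type v) [MetricSpace X] [MetricSpace Y] : ℝ≥0∞ :=
  (⨅ (f : X → Y) (g : Y → X) (_ : Continuous f) (_ : Continuous g),
    max (dis f) (max (codis f g) (dis g))) / 2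

end MazurUlamGH

/-! Finiteness of either distance yields a correspondence of finite distortion `ε`; continuity plays
no role. A coarse version of the reflection proof of Mazur–Ulam (`norm_le_of_correspondence_fix`,
`norm_add_sub_two_smul_le`) bounds the midpoint error by a term linear in `n` times `ε` plus a term
decaying like `2⁻ⁿ`. For the points `0` and `2ᵏ⁺¹x`, taking `n = k` makes this error `O(k)`, so the
rescalings `2⁻ᵏ f (2ᵏ x)` are Cauchy. The limits of selections in both directions are mutually
inverse isometries. For unit balls the same estimate with `ε = 0` gives exact halving, so the
isometry extends by homogeneity under powers of two. Mazur–Ulam then makes isometries linear. -/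

namespace MazurUlamGH

/-! ### Coarse midpoint estimates by reflection. -/

section Midpoint

variable {V : Type*} {W : Type*} [NormedAddCommGroup V] [NormedSpace ℝ V] [NormedAddCommGroup W]

/-- A correspondence of distortion at most `ε` on a symmetric set that fixes `p` and `-p`
almost fixes the origin. -/
theorem norm_le_of_correspondence_fix {A : Set V} (hA : ∀ u ∈ A, -u ∈ A) (p : V) (n : ℕ) :
    ∀ (ε : ℝ) (e : V → V → Prop), (∀ u ∈ A, ∃ v ∈ A, e u v) → (∀ v ∈ A, ∃ u ∈ A, e u v) →
      (∀ u v u' v', e u v → e u' v' → |‖u - u'‖ - ‖v - v'‖| ≤ ε) → e p p → e (-p) (-p) →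
      ∀ u ∈ A, e 0 u → ‖u‖ ≤ (n / 2 + 1) * ε + 2 * ‖p‖ / 2 ^ n := by
  induction n with
  | zero =>
    intro ε e _ _ hd hp _ u _ hu
    have h1 := abs_le.1 (hd _ _ _ _ hu hp)
    have h2 : ‖u‖ ≤ ‖u - p‖ + ‖p‖ := norm_le_norm_sub_add u p
    rw [zero_sub, norm_neg] at h1
    norm_num
    linarith [h1.1]
  | succ n ih =>
    intro ε e hl hr hd hp hp' u huA hu
    obtain ⟨c, hcA, hc⟩ := hr _ (hA u huA)
    -- Composing `e` with the inverse of its conjugate by `-1` doubles the distortion. The new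
    -- relation sends `0` to `-c`, where `2‖u‖ ≤ ‖c‖ + ε`; halving the inductive bound therefore
    -- costs only `ε / 2` more.
    have key := ih (2 * ε) (fun a d => ∃ b, e a b ∧ e (-d) (-b)) ?_ ?_ ?_ ⟨p, hp, hp'⟩
      ⟨-p, hp', by simpa using hp⟩ (-c) (hA c hcA) ⟨u, hu, by simpa using hc⟩
    · have h1 := abs_le.1 (hd _ _ _ _ hc hu)
      have h2 : ‖-u - u‖ = 2 * ‖u‖ := by
        rw [← neg_add', norm_neg, ← two_smul ℝ u, norm_smul]; norm_num
      rw [sub_zero, h2] at h1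
      rw [norm_neg] at key
      have h3 : 2 * ‖p‖ / 2 ^ n = 2 * (2 * ‖p‖ / 2 ^ (n + 1)) := by rw [pow_succ]; field_simp
      rw [h3] at key
      push_cast
      linarith [h1.1]
    · intro a ha
      obtain ⟨b, hb, hab⟩ := hl a ha
      obtain ⟨d, hdA, hbd⟩ := hr _ (hA b hb)
      exact ⟨-d, hA d hdA, b, hab, by simpa using hbd⟩
    · intro d hdA
      obtain ⟨b, hb, hdb⟩ := hl _ (hA d hdA)
      obtain ⟨a, ha, hab⟩ := hr _ (hA b hb)
      exact ⟨a, ha, -b, hab, by simpa using hdb⟩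
    · rintro a d a' d' ⟨b, hab, hdb⟩ ⟨b', hab', hdb'⟩
      have h1 := abs_le.1 (hd _ _ _ _ hab hab')
      have h2 := abs_le.1 (hd _ _ _ _ hdb hdb')
      rw [neg_sub_neg, neg_sub_neg, norm_sub_rev d' d, norm_sub_rev b' b] at h2
      exact abs_le.2 ⟨by linarith [h1.1, h2.2], by linarith [h1.2, h2.1]⟩

/-- A correspondence of distortion at most `ε` between sets that are symmetric about the midpoints
of `a, b` and of the corresponding points `a', b'` almost preserves these midpoints. -/
theorem norm_add_sub_two_smul_le {ρ : V → W → Prop} {ε : ℝ} {A : Set V} {A' : Set W}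
    {a b m : V} {a' b' w : W}
    (hA : ∀ u ∈ A, a + b - u ∈ A) (hA' : ∀ v ∈ A', a' + b' - v ∈ A')
    (hl : ∀ u ∈ A, ∃ v ∈ A', ρ u v) (hr : ∀ v ∈ A', ∃ u ∈ A, ρ u v)
    (hd : ∀ u v u' v', ρ u v → ρ u' v' → |‖u - u'‖ - ‖v - v'‖| ≤ ε)
    (hm : a + b = m + m) (ha : ρ a a') (hb : ρ b b') (hw : ρ m w) (hwA : w ∈ A') (n : ℕ) :
    ‖a' + b' - (w + w)‖ ≤ (n + 3) * ε + 2 * ‖a - m‖ / 2 ^ n := by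
  obtain ⟨x, hxA, hx⟩ := hr _ (hA' w hwA)
  have hb2 : m - (a - m) = b := by rw [sub_sub_eq_add_sub, ← hm]; abel
  have hsymm : ∀ u, m + u ∈ A → m - u ∈ A := fun u hu => by
    have := hA _ hu
    rwa [hm, add_sub_add_left_eq_sub] at this
  -- With `m` as origin, the relation pulls the reflection `y ↦ a' + b' - y` back through `ρ` and
  -- follows it by reflection in `m`. It fixes `±(a - m)` and uses `ρ` twice, whence `2 * ε`.
  have key := norm_le_of_correspondence_fix (A := {s | m + s ∈ A})
    (fun u hu => by simpa [← sub_eq_add_neg] using hsymm u hu) (a - m) n (2 * ε)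
    (fun s t => ∃ y, ρ (m + s) y ∧ ρ (m - t) (a' + b' - y)) ?_ ?_ ?_
    ⟨a', by simpa using ha, by rw [hb2, add_sub_cancel_left]; exact hb⟩
    ⟨b', by rw [← sub_eq_add_neg, hb2]; exact hb, by simpa using ha⟩
    (m - x) (by
      have := hA _ hxA
      rwa [hm, add_sub_assoc] at this)
    ⟨w, by simpa using hw, by simpa using hx⟩
  · have h1 := (abs_le.1 (hd _ _ _ _ hx hw)).1
    rw [norm_sub_rev x m, sub_sub] at h1
    linarith
  · intro s hs
    obtain ⟨y, hyA, hy⟩ := hl _ hs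
    obtain ⟨t, htA, ht⟩ := hr _ (hA' y hyA)
    refine ⟨m - t, ?_, y, hy, by simpa using ht⟩
    have := hA _ htA
    rwa [hm, add_sub_assoc] at this
  · intro t ht
    obtain ⟨y, hyA, hy⟩ := hl _ (hsymm t ht)
    obtain ⟨s, hsA, hs⟩ := hr _ (hA' y hyA)
    exact ⟨s - m, by simpa using hsA, a' + b' - y, by simpa using hs, by simpa using hy⟩
  · rintro s t s' t' ⟨y, hsy, hty⟩ ⟨y', hsy', hty'⟩
    have h1 := abs_le.1 (hd _ _ _ _ hsy hsy')
    have h2 := abs_le.1 (hd _ _ _ _ hty hty')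
    rw [sub_sub_sub_cancel_left, sub_sub_sub_cancel_left, norm_sub_rev t' t,
      norm_sub_rev y' y] at h2
    rw [add_sub_add_left_eq_sub] at h1
    exact abs_le.2 ⟨by linarith [h1.1, h2.2], by linarith [h1.2, h2.1]⟩

end Midpoint

/-! ### From finite distortion to an isometry by rescaling. -/

section HyersUlam

open Filter Topology

variable {V : Type*} {W : Type*} [NormedAddCommGroup V] [NormedSpace ℝ V]
  [NormedAddCommGroup W] [NormedSpace ℝ W]

/-- The rescalings `2⁻ᵏ f (2ᵏ x)` of a selection `f` of a correspondence of finite distortion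
converge. -/
theorem exists_tendsto_rescaling [CompleteSpace W] {ρ : V → W → Prop} {ε : ℝ}
    (hl : ∀ u, ∃ v, ρ u v) (hr : ∀ v, ∃ u, ρ u v)
    (hd : ∀ u v u' v', ρ u v → ρ u' v' → |‖u - u'‖ - ‖v - v'‖| ≤ ε)
    {f : V → W} (hf : ∀ u, ρ u (f u)) (x : V) :
    ∃ y, Tendsto (fun k : ℕ => ((2 : ℝ) ^ k)⁻¹ • f ((2 : ℝ) ^ k • x)) atTop (𝓝 y) := by
  refine cauchySeq_tendsto_of_complete ?_
  refine cauchySeq_of_summable_dist ?_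
  have hs : Summable fun k : ℕ =>
      ε * ((k : ℝ) ^ 1 * (1 / 2 : ℝ) ^ k) + (3 * ε + 2 * ‖x‖ + ‖f 0‖) * (1 / 2 : ℝ) ^ k := by
    have hr : ‖(1 / 2 : ℝ)‖ < 1 := by norm_num
    exact ((summable_pow_mul_geometric_of_norm_lt_one 1 hr).mul_left ε).add
      (summable_geometric_two.mul_left _)
  refine Summable.of_nonneg_of_le (fun _ => dist_nonneg) (fun k => ?_) hs
  have key := norm_add_sub_two_smul_le (A := Set.univ) (A' := Set.univ)
    (a := (2 : ℝ) ^ (k + 1) • x) (b := 0) (m := (2 : ℝ) ^ k • x) (by simp) (by simp)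
    (by simpa using hl) (by simpa using hr) hd
    (by rw [add_zero, pow_succ, mul_two, add_smul]) (hf _) (hf _) (hf _) (Set.mem_univ _) k
  have h1 : ‖(2 : ℝ) ^ (k + 1) • x - (2 : ℝ) ^ k • x‖ = 2 ^ k * ‖x‖ := by
    rw [← sub_smul, pow_succ, mul_two, add_sub_cancel_right, norm_smul]
    simp
  rw [h1] at key
  have h2 : 2 * ((2 : ℝ) ^ k * ‖x‖) / 2 ^ k = 2 * ‖x‖ := by field_simp
  rw [h2] at key
  have h3 : ((2 : ℝ) ^ k)⁻¹ • f ((2 : ℝ) ^ k • x)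
        - ((2 : ℝ) ^ (k + 1))⁻¹ • f ((2 : ℝ) ^ (k + 1) • x)
      = ((2 : ℝ) ^ (k + 1))⁻¹ • (f 0 - (f ((2 : ℝ) ^ (k + 1) • x) + f 0
        - (f ((2 : ℝ) ^ k • x) + f ((2 : ℝ) ^ k • x)))) := by
    have : ((2 : ℝ) ^ k)⁻¹ = ((2 : ℝ) ^ (k + 1))⁻¹ * 2 := by rw [pow_succ]; field_simp
    rw [this]
    generalize f ((2 : ℝ) ^ (k + 1) • x) = y
    generalize f ((2 : ℝ) ^ k • x) = z
    rw [mul_smul, two_smul, ← smul_sub]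
    congr 1
    abel
  rw [dist_eq_norm, h3, norm_smul, norm_inv, norm_pow, Real.norm_ofNat]
  have h4 := (norm_sub_le (f 0) (f ((2 : ℝ) ^ (k + 1) • x) + f 0
        - (f ((2 : ℝ) ^ k • x) + f ((2 : ℝ) ^ k • x)))).trans (add_le_add_right key _)
  have h5 : ((2 : ℝ) ^ (k + 1))⁻¹ ≤ (1 / 2) ^ k := by
    rw [one_div, inv_pow]
    exact inv_anti₀ (by positivity) (pow_le_pow_right₀ (by norm_num) (Nat.le_succ k))
  calc _ ≤ (1 / 2 : ℝ) ^ k * (‖f 0‖ + ((k + 3) * ε + 2 * ‖x‖)) :=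
        mul_le_mul h5 h4 (norm_nonneg _) (by positivity)
    _ = _ := by ring

/-- If `|‖u k‖ - ‖v k‖|` stays bounded, the rescaled sequences have limits of equal norm. -/
theorem norm_eq_of_tendsto_rescaling {ε : ℝ} {u : ℕ → V} {v : ℕ → W} {a : V} {b : W}
    (h : ∀ k, |‖u k‖ - ‖v k‖| ≤ ε)
    (hu : Tendsto (fun k : ℕ => ((2 : ℝ) ^ k)⁻¹ • u k) atTop (𝓝 a))
    (hv : Tendsto (fun k : ℕ => ((2 : ℝ) ^ k)⁻¹ • v k) atTop (𝓝 b)) : ‖a‖ = ‖b‖ := by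
  have h1 : Tendsto (fun k : ℕ => ((2 : ℝ) ^ k)⁻¹ * ε) atTop (𝓝 0) := by
    have := (tendsto_pow_atTop_nhds_zero_of_lt_one (r := (1 / 2 : ℝ)) (by norm_num)
      (by norm_num)).mul_const ε
    simpa [one_div, inv_pow] using this
  have h2 := squeeze_zero_norm (fun k => ?_) h1 (f := fun k : ℕ =>
    ‖((2 : ℝ) ^ k)⁻¹ • u k‖ - ‖((2 : ℝ) ^ k)⁻¹ • v k‖)
  · exact sub_eq_zero.1 (tendsto_nhds_unique (hu.norm.sub hv.norm) h2)
  · rw [norm_smul, norm_smul, ← mul_sub, norm_mul, norm_norm, norm_inv, norm_pow,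
      Real.norm_ofNat, Real.norm_eq_abs]
    exact mul_le_mul_of_nonneg_left (h k) (by positivity)

/-- Banach spaces related by a correspondence of finite distortion are isometric. -/
theorem nonempty_isometryEquiv_of_correspondence [CompleteSpace V] [CompleteSpace W]
    {ρ : V → W → Prop} {ε : ℝ} (hl : ∀ u, ∃ v, ρ u v) (hr : ∀ v, ∃ u, ρ u v)
    (hd : ∀ u v u' v', ρ u v → ρ u' v' → |‖u - u'‖ - ‖v - v'‖| ≤ ε) :
    Nonempty (V ≃ᵢ W) := by
  choose f hf using hl
  choose g hg using hr
  choose F hF using exists_tendsto_rescaling (fun u => ⟨_, hf u⟩) (fun v => ⟨_, hg v⟩) hd hf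
  choose G hG using exists_tendsto_rescaling (ρ := fun v u => ρ u v) (fun v => ⟨_, hg v⟩)
    (fun u => ⟨_, hf u⟩) (fun v u v' u' h h' => by rw [abs_sub_comm]; exact hd _ _ _ _ h h') hg
  -- Putting `x = G y` here gives `F (G y) = y`, hence surjectivity.
  have hFG : ∀ x y, ‖F x - y‖ = ‖x - G y‖ := fun x y => by
    refine (norm_eq_of_tendsto_rescaling (ε := ε)
      (u := fun k => (2 : ℝ) ^ k • x - g ((2 : ℝ) ^ k • y))
      (v := fun k => f ((2 : ℝ) ^ k • x) - (2 : ℝ) ^ k • y)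
      (fun k => hd _ _ _ _ (hf _) (hg _)) ?_ ?_).symm
    · simpa [smul_sub] using hG y |>.const_sub x
    · simpa [smul_sub] using hF x |>.sub_const y
  refine ⟨IsometryEquiv.mk' F G (fun y => ?_) (Isometry.of_dist_eq fun x x' => ?_)⟩
  · rw [← sub_eq_zero, ← norm_eq_zero, hFG, sub_self, norm_zero]
  · rw [dist_eq_norm, dist_eq_norm]
    refine (norm_eq_of_tendsto_rescaling (ε := ε)
      (u := fun k => (2 : ℝ) ^ k • x - (2 : ℝ) ^ k • x')
      (v := fun k => f ((2 : ℝ) ^ k • x) - f ((2 : ℝ) ^ k • x'))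
      (fun k => hd _ _ _ _ (hf _) (hf _)) ?_ ?_).symm
    · simp [smul_sub]
    · simpa [smul_sub] using (hF x).sub (hF x')

end HyersUlam

/-! ### Extending isometries of unit balls. -/

section UnitBall

open Metric

variable {V : Type*} {W : Type*} [NormedAddCommGroup V] [NormedAddCommGroup W] [NormedSpace ℝ W]

/-- A surjective isometry between closed unit balls fixes the centre. -/
theorem coe_closedBall_isometry_zero (f : closedBall (0 : V) 1 ≃ᵢ closedBall (0 : W) 1)
    {z : closedBall (0 : V) 1} (hz : (z : V) = 0) : (f z : W) = 0 := by
  by_contra h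
  have hn : 0 < ‖(f z : W)‖ := norm_pos_iff.2 h
  -- The unit vector opposite to `f z` lies at distance `‖f z‖ + 1` from it, while no point of the
  -- ball is farther than `1` from its centre.
  let v : closedBall (0 : W) 1 := ⟨-(‖(f z : W)‖⁻¹ • (f z : W)), by
    rw [mem_closedBall_zero_iff, norm_neg, norm_smul, norm_inv, norm_norm,
      inv_mul_cancel₀ hn.ne']⟩
  have h1 : dist (f z) v = dist z (f.symm v) := by rw [← f.dist_eq, f.apply_symm_apply]
  have h2 : dist z (f.symm v) ≤ 1 := by
    rw [Subtype.dist_eq, hz, dist_zero_left]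
    exact mem_closedBall_zero_iff.1 (f.symm v).2
  have h3 : dist (f z) v = ‖(f z : W)‖ + 1 := by
    have : (f z : W) - v = (1 + ‖(f z : W)‖⁻¹) • (f z : W) := by
      simp only [v]; module
    rw [Subtype.dist_eq, dist_eq_norm, this, norm_smul, Real.norm_of_nonneg (by positivity)]
    field_simp
  linarith

variable [NormedSpace ℝ V]

/-- A surjective isometry between closed unit balls commutes with halving. -/
theorem coe_closedBall_isometry_half (f : closedBall (0 : V) 1 ≃ᵢ closedBall (0 : W) 1)
    {x y : closedBall (0 : V) 1} (hxy : (x : V) = (2 : ℝ) • (y : V)) :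
    (f x : W) = (2 : ℝ) • (f y : W) := by
  let z : closedBall (0 : V) 1 := ⟨0, by simp⟩
  have hfz : (f z : W) = 0 := coe_closedBall_isometry_zero f rfl
  have hx : ‖(f x : W)‖ = ‖(x : V)‖ := by
    have := f.dist_eq x z
    rwa [Subtype.dist_eq, Subtype.dist_eq, hfz, dist_zero_right, dist_zero_right] at this
  have hx1 : ‖(x : V)‖ ≤ 1 := mem_closedBall_zero_iff.1 x.2
  have hfd : ∀ u v, ‖(f u : W) - f v‖ = ‖(u : V) - v‖ := fun u v => by
    rw [← dist_eq_norm, ← dist_eq_norm]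
    exact f.dist_eq u v
  have hf0 : ∀ u, ‖(f u : W)‖ = ‖(u : V)‖ := fun u => by
    simpa [hfz, z] using hfd u z
  -- Reflection in `y = x / 2` need not preserve the unit ball. The lens of two balls of radius
  -- `‖x‖` about `0` and `x` is symmetric about `y`, stays in the unit ball, and is carried by `f`
  -- onto its counterpart.
  have key := fun n => norm_add_sub_two_smul_le (ε := 0)
    (ρ := fun u v => ∃ s : closedBall (0 : V) 1, (s : V) = u ∧ (f s : W) = v)
    (A := {u : V | ‖u‖ ≤ ‖(x : V)‖ ∧ ‖u - x‖ ≤ ‖(x : V)‖})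
    (A' := {u : W | ‖u‖ ≤ ‖(x : V)‖ ∧ ‖u - f x‖ ≤ ‖(x : V)‖})
    (a := x) (b := 0) (m := y) (a' := f x) (b' := 0) (w := f y)
    (by
      rintro u ⟨h1, h2⟩
      exact ⟨by rwa [add_zero, norm_sub_rev], by simpa using h1⟩)
    (by
      rintro u ⟨h1, h2⟩
      exact ⟨by rwa [add_zero, norm_sub_rev], by simpa using h1⟩)
    (by
      rintro u ⟨h1, h2⟩
      let s : closedBall (0 : V) 1 := ⟨u, mem_closedBall_zero_iff.2 (h1.trans hx1)⟩
      exact ⟨f s, ⟨(hf0 s).trans_le h1, (hfd s x).trans_le h2⟩, s, rfl, rfl⟩)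
    (by
      rintro v ⟨h1, h2⟩
      let t : closedBall (0 : W) 1 := ⟨v, mem_closedBall_zero_iff.2 (h1.trans hx1)⟩
      have ht : (f (f.symm t) : W) = v := by rw [f.apply_symm_apply]
      refine ⟨f.symm t, ⟨?_, ?_⟩, f.symm t, rfl, ht⟩
      · rwa [← hf0, ht]
      · rwa [← hfd, ht])
    (by
      rintro _ _ _ _ ⟨s, rfl, rfl⟩ ⟨t, rfl, rfl⟩
      rw [hfd, sub_self, abs_zero])
    (by rw [add_zero, hxy, two_smul]) ⟨x, rfl, rfl⟩ ⟨z, rfl, hfz⟩ ⟨y, rfl, rfl⟩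
    (by
      have h2 : ‖(x : V)‖ = 2 * ‖(y : V)‖ := by rw [hxy, norm_smul, Real.norm_ofNat]
      have h3 : (y : V) - x = -(y : V) := by rw [hxy, two_smul]; abel
      refine ⟨?_, ?_⟩
      · rw [hf0]; linarith [norm_nonneg (y : V)]
      · rw [hfd, h3, norm_neg]; linarith [norm_nonneg (y : V)]) n
  have hlim : Filter.Tendsto (fun n : ℕ => 2 * ‖(x : V) - y‖ / 2 ^ n) Filter.atTop (nhds 0) := by
    have := (tendsto_pow_atTop_nhds_zero_of_lt_one (r := (1 / 2 : ℝ)) (by norm_num)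
      (by norm_num)).const_mul (2 * ‖(x : V) - y‖)
    simpa [one_div, inv_pow, div_eq_mul_inv] using this
  have h0 := ge_of_tendsto' hlim fun n => by simpa using key n
  rw [two_smul]
  exact sub_eq_zero.1 (norm_le_zero_iff.1 h0)

theorem inv_two_pow_smul_mem_closedBall {x : V} {n : ℕ} (hn : ‖x‖ ≤ n) :
    ((2 : ℝ) ^ n)⁻¹ • x ∈ closedBall (0 : V) 1 := by
  rw [mem_closedBall_zero_iff, norm_smul, norm_inv, norm_pow, Real.norm_ofNat]
  have h1 : (n : ℝ) ≤ 2 ^ n := by exact_mod_cast Nat.lt_two_pow_self.le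
  rw [inv_mul_le_iff₀ (by positivity)]
  linarith

/-- Normed spaces with isometric closed unit balls are isometric. -/
theorem nonempty_isometryEquiv_of_closedBall
    (f : closedBall (0 : V) 1 ≃ᵢ closedBall (0 : W) 1) : Nonempty (V ≃ᵢ W) := by
  let F : V → W := fun x =>
    (2 : ℝ) ^ ⌈‖x‖⌉₊ • (f ⟨_, inv_two_pow_smul_mem_closedBall (Nat.le_ceil ‖x‖)⟩ : W)
  have hF : ∀ (x : V) (n : ℕ) (s : closedBall (0 : V) 1), ⌈‖x‖⌉₊ ≤ n →
      (s : V) = ((2 : ℝ) ^ n)⁻¹ • x → F x = (2 : ℝ) ^ n • (f s : W) := by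
    intro x n s hn
    induction n, hn using Nat.le_induction generalizing s with
    | base =>
      intro hs
      simp only [F]
      congr 3
      exact Subtype.ext hs.symm
    | succ n hn ih =>
      intro hs
      have hxn : ‖x‖ ≤ n := (Nat.le_ceil _).trans (by exact_mod_cast hn)
      rw [ih ⟨_, inv_two_pow_smul_mem_closedBall hxn⟩ rfl,
        coe_closedBall_isometry_half f (y := s), smul_smul, pow_succ]
      rw [hs, smul_smul, pow_succ]
      field_simp
  have hiso : Isometry F := Isometry.of_dist_eq fun x y => by
    let n := max ⌈‖x‖⌉₊ ⌈‖y‖⌉₊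
    have hx : ‖x‖ ≤ n := (Nat.le_ceil _).trans (by exact_mod_cast le_max_left _ _)
    have hy : ‖y‖ ≤ n := (Nat.le_ceil _).trans (by exact_mod_cast le_max_right _ _)
    rw [hF x n ⟨_, inv_two_pow_smul_mem_closedBall hx⟩ (le_max_left _ _) rfl,
      hF y n ⟨_, inv_two_pow_smul_mem_closedBall hy⟩ (le_max_right _ _) rfl, dist_smul₀,
      ← Subtype.dist_eq, f.dist_eq, Subtype.dist_eq, ← dist_smul₀,
      smul_inv_smul₀ (by positivity), smul_inv_smul₀ (by positivity)]
  have hsurj : Function.Surjective F := fun y => by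
    let n := ⌈‖y‖⌉₊
    let t : closedBall (0 : W) 1 := ⟨_, inv_two_pow_smul_mem_closedBall (Nat.le_ceil ‖y‖)⟩
    let x : V := (2 : ℝ) ^ n • (f.symm t : V)
    refine ⟨x, ?_⟩
    have hs : ‖(f.symm t : V)‖ = ‖(t : W)‖ := by
      have := f.dist_eq (f.symm t) ⟨0, by simp⟩
      rw [Subtype.dist_eq, Subtype.dist_eq, coe_closedBall_isometry_zero f (z := ⟨0, by simp⟩) rfl,
        f.apply_symm_apply] at this
      simpa using this.symm
    have hx : ‖x‖ = ‖y‖ := by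
      have hy : y = (2 : ℝ) ^ n • (t : W) := (smul_inv_smul₀ (by positivity) y).symm
      rw [hy, norm_smul, norm_smul, hs]
    rw [hF x n (f.symm t) (by rw [hx]) (inv_smul_smul₀ (by positivity) _).symm,
      f.apply_symm_apply]
    exact smul_inv_smul₀ (by positivity) y
  exact ⟨⟨Equiv.ofBijective F ⟨hiso.injective, hsurj⟩, hiso⟩⟩

end UnitBall

/-! ### Correspondences from finite distances. -/

section GromovHausdorff

variable {X : Type u} {Y : Type v} [MetricSpace X] [MetricSpace Y]

theorem cghEDist_eq_zero (e : X ≃ᵢ Y) : cghEDist X Y = 0 := by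
  have h : max (dis e) (max (codis e e.symm) (dis e.symm)) ≤ 0 := by
    refine max_le ?_ (max_le ?_ ?_)
    · exact iSup₂_le fun x x' => by simp [e.dist_eq]
    · refine iSup₂_le fun x y => ?_
      rw [← e.dist_eq x, e.apply_symm_apply]
      simp
    · exact iSup₂_le fun x x' => by simp [e.symm.dist_eq]
  rw [cghEDist, ENNReal.div_eq_zero_iff]
  exact Or.inl (le_zero_iff.1 (iInf_le_of_le e (iInf_le_of_le e.symm
    (iInf_le_of_le e.continuous (iInf_le_of_le e.symm.continuous h)))))

theorem ghEDist_lt_top (e : X ≃ᵢ Y) : ghEDist X Y < ⊤ := by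
  have h1 : Isometry (fun x : X => ULift.up.{max u v} (e x)) := fun x x' => e.edist_eq x x'
  have h2 : Isometry (ULift.up.{max u v} : Y → ULift.{max u v} Y) := fun _ _ => rfl
  refine lt_of_le_of_lt (iInf_le_of_le (ULift.{max u v} Y) (iInf_le_of_le inferInstance
    (iInf_le_of_le _ (iInf_le_of_le _ (iInf_le_of_le h1 (iInf_le_of_le h2 le_rfl)))))) ?_
  have : Set.range (fun x : X => ULift.up.{max u v} (e x)) =
      Set.range (ULift.up.{max u v} : Y → ULift.{max u v} Y) := e.surjective.range_comp _
  rw [this, Metric.hausdorffEDist_self]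
  exact ENNReal.zero_lt_top

theorem abs_le_toReal_of_ofReal_le {a : ℝ} {b c : ENNReal} (h : ENNReal.ofReal |a| ≤ b)
    (hbc : b ≤ c) (hc : c < ⊤) : |a| ≤ c.toReal :=
  (ENNReal.ofReal_le_iff_le_toReal hc.ne).1 (h.trans hbc)

/-- The union of the graph of `f` and the transposed graph of `g` works: `dis` controls pairs from
the same graph, `codis` mixed pairs. -/
theorem exists_correspondence_of_cghEDist_lt_top (h : cghEDist X Y < ⊤) :
    ∃ (ρ : X → Y → Prop) (ε : ℝ), (∀ u, ∃ v, ρ u v) ∧ (∀ v, ∃ u, ρ u v) ∧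
      ∀ u v u' v', ρ u v → ρ u' v' → |dist u u' - dist v v'| ≤ ε := by
  have h0 : (⨅ (f : X → Y) (g : Y → X) (_ : Continuous f) (_ : Continuous g),
      max (dis f) (max (codis f g) (dis g))) < ⊤ :=
    lt_top_iff_ne_top.2 fun h' => h.ne (by rw [cghEDist, h', ENNReal.top_div_of_ne_top (by simp)])
  simp only [iInf_lt_iff] at h0
  obtain ⟨f, g, -, -, h⟩ := h0
  set C := max (dis f) (max (codis f g) (dis g))
  have hf : ∀ x x', |dist (f x) (f x') - dist x x'| ≤ C.toReal := fun x x' =>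
    abs_le_toReal_of_ofReal_le (le_iSup₂ (f := fun x x' : X =>
      ENNReal.ofReal |dist (f x) (f x') - dist x x'|) x x') (le_max_left _ _) h
  have hfg : ∀ x y, |dist (f x) y - dist x (g y)| ≤ C.toReal := fun x y =>
    abs_le_toReal_of_ofReal_le (le_iSup₂ (f := fun (x : X) (y : Y) =>
      ENNReal.ofReal |dist (f x) y - dist x (g y)|) x y)
      ((le_max_left _ _).trans (le_max_right _ _)) h
  have hg : ∀ y y', |dist (g y) (g y') - dist y y'| ≤ C.toReal := fun y y' =>
    abs_le_toReal_of_ofReal_le (le_iSup₂ (f := fun y y' : Y =>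
      ENNReal.ofReal |dist (g y) (g y') - dist y y'|) y y')
      ((le_max_right _ _).trans (le_max_right _ _)) h
  refine ⟨fun x y => y = f x ∨ x = g y, C.toReal, fun x => ⟨f x, Or.inl rfl⟩,
    fun y => ⟨g y, Or.inr rfl⟩, ?_⟩
  rintro x y x' y' (rfl | rfl) (rfl | rfl)
  · rw [abs_sub_comm]; exact hf _ _
  · rw [abs_sub_comm]; exact hfg _ _
  · rw [abs_sub_comm, dist_comm y, dist_comm _ x']; exact hfg _ _
  · exact hg _ _

/-- Points at distance at most `r` in a common space are related; the triangle inequality gives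
distortion `2 * r`. -/
theorem exists_correspondence_of_ghEDist_lt_top (h : ghEDist X Y < ⊤) :
    ∃ (ρ : X → Y → Prop) (ε : ℝ), (∀ u, ∃ v, ρ u v) ∧ (∀ v, ∃ u, ρ u v) ∧
      ∀ u v u' v', ρ u v → ρ u' v' → |dist u u' - dist v v'| ≤ ε := by
  simp only [ghEDist, iInf_lt_iff] at h
  obtain ⟨Z, _, f, g, hf, hg, h⟩ := h
  obtain ⟨r, hr, -⟩ := ENNReal.lt_iff_exists_nnreal_btwn.1 h
  refine ⟨fun x y => dist (f x) (g y) ≤ r, 2 * r, fun x => ?_, fun y => ?_, ?_⟩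
  · obtain ⟨_, ⟨y, rfl⟩, hy⟩ :=
      Metric.exists_edist_lt_of_hausdorffEDist_lt (Set.mem_range_self x) hr
    rw [edist_nndist] at hy
    exact ⟨y, by exact_mod_cast hy.le⟩
  · rw [Metric.hausdorffEDist_comm] at hr
    obtain ⟨_, ⟨x, rfl⟩, hx⟩ :=
      Metric.exists_edist_lt_of_hausdorffEDist_lt (Set.mem_range_self y) hr
    rw [edist_comm, edist_nndist] at hx
    exact ⟨x, by exact_mod_cast hx.le⟩
  · intro x y x' y' h1 h2
    rw [← hf.dist_eq, ← hg.dist_eq]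
    have h3 := dist_triangle4 (f x) (g y) (g y') (f x')
    have h4 := dist_triangle4 (g y) (f x) (f x') (g y')
    rw [dist_comm (g y') (f x')] at h3
    rw [dist_comm (g y) (f x)] at h4
    exact abs_le.2 ⟨by linarith, by linarith⟩

end GromovHausdorff

/-- The closed unit balls of linearly isometric spaces are isometric. -/
theorem nonempty_closedBall_isometryEquiv {V W : Type*} [NormedAddCommGroup V] [NormedSpace ℝ V]
    [NormedAddCommGroup W] [NormedSpace ℝ W] (e : V ≃ₗᵢ[ℝ] W) :
    Nonempty (Metric.closedBall (0 : V) 1 ≃ᵢ Metric.closedBall (0 : W) 1) :=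
  ⟨⟨e.toEquiv.subtypeEquiv fun x => by simp, fun x y => e.isometry x y⟩⟩

end MazurUlamGH

theorem mainTheorem1 (V : Type u) (W : Type v)
    [NormedAddCommGroup V] [NormedSpace ℝ V] [CompleteSpace V]
    [NormedAddCommGroup W] [NormedSpace ℝ W] [CompleteSpace W] :
    List.TFAE
      [Nonempty (V ≃ₗᵢ[ℝ] W),
       Nonempty (V ≃ᵢ W),
       MazurUlamGH.cghEDist V W = 0,
       MazurUlamGH.cghEDist V W < ⊤,
       MazurUlamGH.ghEDist V W < ⊤,
       Nonempty (Metric.closedBall (0 : V) 1 ≃ᵢ Metric.closedBall (0 : W) 1)] := by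
  tfae_have 1 → 6 := fun ⟨e⟩ => MazurUlamGH.nonempty_closedBall_isometryEquiv e
  tfae_have 6 → 2 := fun ⟨f⟩ => MazurUlamGH.nonempty_isometryEquiv_of_closedBall f
  tfae_have 2 → 1 := fun ⟨f⟩ => ⟨f.toRealLinearIsometryEquiv⟩
  tfae_have 2 → 3 := fun ⟨f⟩ => MazurUlamGH.cghEDist_eq_zero f
  tfae_have 3 → 4 := fun h => h ▸ ENNReal.zero_lt_top
  tfae_have 2 → 5 := fun ⟨f⟩ => MazurUlamGH.ghEDist_lt_top f
  tfae_have 4 → 2 := fun h => by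
    obtain ⟨ρ, ε, hl, hr, hd⟩ := MazurUlamGH.exists_correspondence_of_cghEDist_lt_top h
    simp only [dist_eq_norm] at hd
    exact MazurUlamGH.nonempty_isometryEquiv_of_correspondence hl hr hd
  tfae_have 5 → 2 := fun h => by
    obtain ⟨ρ, ε, hl, hr, hd⟩ := MazurUlamGH.exists_correspondence_of_ghEDist_lt_top h
    simp only [dist_eq_norm] at hd
    exact MazurUlamGH.nonempty_isometryEquiv_of_correspondence hl hr hd
  tfae_finish
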